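/- A random recursive tree $T_n$ of size $n\ge 1$ is obtained as follows: $T_1$ is a single vertex labelled $1$, the root; for $n>1$, $T_n$ arises from $T_{n-1}$ by adding a new vertex labelled $n$ and an edge directed from it to a vertex chosen uniformly at random from $\{1,\dots,n-1\}$, independently for each $n$. The degree of a vertex is the number of edges directed towards it. Enumerate the vertices of $T_n$ as $v^{(1)},\dots,v^{(n)}$ so that $\deg(v^{(1)})\ge\cdots\ge\deg(v^{(n)})$, breaking ties uniformly at random. In the targeted vertex-cutting of $T_n$ the vertices $v^{(1)},v^{(2)},\dots$ are removed one after the other, and after each removal only the subtree containing the root is kept; a vertex that is no longer present is skipped, and the procedure ends when the root is picked. Let $X_n^{targ}$ be the number of vertices removed before the root is picked. **Theorem.** Let $\gamma := 1-\ln 2$. For every $\varepsilon>0$, $X_n^{targ}=O_p(n^{\gamma+\varepsilon})$; that is, for all $\varepsilon>0$ and $\delta>0$ there are $M=M(\varepsilon,\delta)>0$ and $N=N(\varepsilon,\delta)\in\mathbb N$ such that for all $n\ge N$ with $n\ge 1$, $$\mathbb P\left(X_n^{targ}>M\,n^{\gamma+\varepsilon}\right)<\delta .$$ -/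

import Mathlib

/-- Recursive (increasing) trees of size `n`. The vertices are the elements of `Fin n`; the element
`i` of `Fin n` stands for the vertex labelled `i + 1`. A recursive tree of size `1` is a single
vertex; one of size `n + 1` arises from one of size `n` by adding the vertex with the largest label
together with an edge directed from it to a vertex `p` of the smaller tree. -/
inductive RecTree : ℕ → Type
  | single : RecTree 1
  | attach {n : ℕ} (T : RecTree n) (p : Fin n) : RecTree (n + 1)

namespace RecTree

/-- The root: the vertex of the initial tree of size `1`. -/
def root : {n : ℕ} → RecTree n → Fin n
  | _, single => 0
  | _, attach T _ => T.root.castSucc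

/-- The parent of a vertex (`none` for the root). -/
def parent : {n : ℕ} → RecTree n → Fin n → Option (Fin n)
  | _, single => fun _ => none
  | _, attach T p =>
      Fin.lastCases (some p.castSucc) (fun v => (T.parent v).map Fin.castSucc)

/-- The degree of `v`: the number of edges directed towards `v`, that is, of children of `v`. -/
def deg {n : ℕ} (T : RecTree n) (v : Fin n) : ℕ :=
  (Finset.univ.filter fun u => T.parent u = some v).card

/-- The underlying undirected graph. -/
def graph {n : ℕ} (T : RecTree n) : SimpleGraph (Fin n) :=
  SimpleGraph.fromRel fun u v => T.parent u = some v

/-- The vertex set of the connected component of the root in the subgraph induced on `S`. -/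
def rootComponent {n : ℕ} (T : RecTree n) (S : Set (Fin n)) : Set (Fin n) :=
  {w | ∃ (hr : T.root ∈ S) (hw : w ∈ S), (T.graph.induce S).Reachable ⟨T.root, hr⟩ ⟨w, hw⟩}

open Classical in
/-- The vertices in the list are picked one after the other, `S` being the current set of vertices.
When the root is picked, the procedure ends. A picked vertex that is no longer present is skipped.
Any other picked vertex is deleted, and only the part that contains the root is kept.
The value is the number of vertices deleted before the root is picked. -/
noncomputable def numCuts {n : ℕ} (T : RecTree n) : List (Fin n) → Set (Fin n) → ℕ
  | [], _ => 0
  | v :: l, S =>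
      if v = T.root then 0
      else if v ∈ S then numCuts T l (T.rootComponent (S \ {v})) + 1
      else numCuts T l S

/-- The enumerations `σ 0, σ 1, …` of the vertices in decreasing order of their degrees. -/
def DegreeOrder {n : ℕ} (T : RecTree n) : Type :=
  {σ : Equiv.Perm (Fin n) // ∀ i j : Fin n, i ≤ j → T.deg (σ j) ≤ T.deg (σ i)}

instance {n : ℕ} (T : RecTree n) : Fintype T.DegreeOrder :=
  inferInstanceAs (Fintype
    {σ : Equiv.Perm (Fin n) // ∀ i j : Fin n, i ≤ j → T.deg (σ j) ≤ T.deg (σ i)})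

instance {n : ℕ} (T : RecTree n) : Nonempty T.DegreeOrder :=
  ⟨⟨Tuple.sort fun v => OrderDual.toDual (T.deg v), fun _ _ h =>
    Tuple.monotone_sort (fun v => OrderDual.toDual (T.deg v)) h⟩⟩

end RecTree

/-- The law of the random recursive tree of size `n ≥ 1`: the new vertex is attached to a vertex
that is uniformly distributed on the current tree, independently of the past. -/
noncomputable def randomRecTree : (n : ℕ) → 0 < n → PMF (RecTree n)
  | 0, h => absurd h (lt_irrefl 0)
  | 1, _ => PMF.pure RecTree.single
  | n + 2, _ =>
      (randomRecTree (n + 1) n.succ_pos).bind fun T =>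
        (PMF.uniformOfFintype (Fin (n + 1))).map fun p => T.attach p

/-- The law of the number of cuts in the targeted cutting of a random recursive tree of size `n`:
given the tree, the enumeration is uniform among those in decreasing order of the degrees (ties are
broken uniformly at random), and the procedure starts from the whole tree. -/
noncomputable def targetedCutsLaw (n : ℕ) (hn : 0 < n) : PMF ℕ :=
  (randomRecTree n hn).bind fun T =>
    (PMF.uniformOfFintype T.DegreeOrder).map fun σ => T.numCuts (List.ofFn σ.1) Set.univ

open Finset Filter Topology

/-! ### Degrees and cuts on a fixed tree. -/

namespace RecTree

/-! The procedure ends when the root is picked, so there are at most as many cuts as vertices of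
degree at least that of the root (`numCuts_degreeOrder_le`). The root degree is about `ln n`. Take
the threshold `a = (1 - η) ln n`. A Chernoff bound from `E (1 - t) ^ deg root ≤ n ^ (-t)` makes root
degree at most `a` unlikely. Since `E ∑ 2 ^ deg v ≤ n (1 + ln n)`, the expected number of vertices
of degree at least `a` is at most `2 ^ (-a) n (1 + ln n)`, which is `n ^ (1 - ln 2 + η ln 2)` up to
a logarithm; Markov's inequality finishes. `one_le_of_lt_numCuts` merges both cases into one
pointwise bound, integrated in `targetedCutsLaw_real_lt_le`. -/

lemma parent_attach_last {n : ℕ} (T : RecTree n) (p : Fin n) :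
    (T.attach p).parent (Fin.last n) = some p.castSucc := by
  simp [parent]

lemma parent_attach_castSucc {n : ℕ} (T : RecTree n) (p u : Fin n) :
    (T.attach p).parent u.castSucc = (T.parent u).map Fin.castSucc := by
  simp [parent]

lemma deg_attach_castSucc {n : ℕ} (T : RecTree n) (p v : Fin n) :
    (T.attach p).deg v.castSucc = T.deg v + if p = v then 1 else 0 := by
  have h (u : Fin n) : (T.parent u).map Fin.castSucc = some v.castSucc ↔ T.parent u = some v := by
    cases T.parent u <;> simp
  simp only [deg, card_filter, Fin.sum_univ_castSucc, parent_attach_last, parent_attach_castSucc, h,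
    Option.some.injEq, Fin.castSucc_inj]

lemma deg_attach_last {n : ℕ} (T : RecTree n) (p : Fin n) :
    (T.attach p).deg (Fin.last n) = 0 := by
  have h (u : Fin n) : ¬ (T.parent u).map Fin.castSucc = some (Fin.last n) := by
    cases T.parent u <;> simp [Fin.castSucc_ne_last]
  rw [deg, card_filter, Fin.sum_univ_castSucc]
  simp only [parent_attach_last, parent_attach_castSucc, h, Option.some.injEq,
    Fin.castSucc_ne_last, if_false, sum_const_zero]

lemma deg_single (v : Fin 1) : single.deg v = 0 := by
  simp [deg, parent]

/-- At most the vertices listed before the root are cut. -/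
lemma numCuts_append_root_le {n : ℕ} (T : RecTree n) (l l' : List (Fin n)) (S : Set (Fin n)) :
    T.numCuts (l ++ T.root :: l') S ≤ l.length := by
  induction l generalizing S with
  | nil => simp [numCuts]
  | cons v l ih =>
    simp only [List.cons_append, numCuts, List.length_cons]
    split_ifs
    · exact Nat.zero_le _
    · exact Nat.succ_le_succ (ih _)
    · exact (ih _).trans (Nat.le_succ _)

lemma numCuts_le_of_getElem_eq_root {n : ℕ} (T : RecTree n) (l : List (Fin n)) (j : ℕ)
    (hj : j < l.length) (h : l[j] = T.root) (S : Set (Fin n)) : T.numCuts l S ≤ j := by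
  have hl : l = l.take j ++ T.root :: l.drop (j + 1) := by
    rw [← h, ← List.drop_eq_getElem_cons hj, List.take_append_drop]
  rw [hl]
  exact (numCuts_append_root_le T _ _ S).trans (by simp)

lemma numCuts_degreeOrder_le {n : ℕ} (T : RecTree n) (σ : T.DegreeOrder) (S : Set (Fin n)) :
    T.numCuts (List.ofFn σ.1) S ≤ #{v | T.deg T.root ≤ T.deg v} := by
  set j := σ.1.symm T.root with hj
  have hσ : σ.1 j = T.root := by simp [hj]
  have h1 : T.numCuts (List.ofFn σ.1) S ≤ j :=
    numCuts_le_of_getElem_eq_root T _ j (by simp) (by simpa using hσ) S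
  -- All vertices up to the root's position `j` have at least its degree, however ties are broken.
  have h2 : #((Iic j).map σ.1.toEmbedding) ≤ #{v | T.deg T.root ≤ T.deg v} := by
    refine card_le_card fun v hv => ?_
    obtain ⟨i, hi, rfl⟩ := mem_map.1 hv
    rw [mem_filter]
    exact ⟨mem_univ _, hσ ▸ σ.2 i j (mem_Iic.1 hi)⟩
  rw [card_map, Fin.card_Iic] at h2
  omega

/-- The generating sum of the degrees at `2`. -/
noncomputable def sumTwoPowDeg {n : ℕ} (T : RecTree n) : ℝ := ∑ v, (2 : ℝ) ^ T.deg v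

lemma sumTwoPowDeg_nonneg {n : ℕ} (T : RecTree n) : 0 ≤ T.sumTwoPowDeg :=
  sum_nonneg fun _ _ => by positivity

lemma sumTwoPowDeg_attach {n : ℕ} (T : RecTree n) (p : Fin n) :
    (T.attach p).sumTwoPowDeg = T.sumTwoPowDeg + 2 ^ T.deg p + 1 := by
  have h (v : Fin n) : (2 : ℝ) ^ (T.deg v + if p = v then 1 else 0)
      = 2 ^ T.deg v + if p = v then 2 ^ T.deg v else 0 := by
    split_ifs
    · ring
    · simp
  simp [sumTwoPowDeg, Fin.sum_univ_castSucc, deg_attach_castSucc, deg_attach_last, h,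
    sum_add_distrib]

/-- Attaching at `p` doubles the term of `p`, and the new leaf adds 1. Base 2 gives the best
exponent for a threshold near `ln n`: base `z < 2` yields `1 - ln z`, base `z > 2` yields `z - 1 -
ln z`, both larger than `1 - ln 2`. -/
lemma sum_sumTwoPowDeg_attach {n : ℕ} (T : RecTree n) :
    ∑ p, (T.attach p).sumTwoPowDeg = (n + 1) * T.sumTwoPowDeg + n := by
  simp only [sumTwoPowDeg_attach, sum_add_distrib, sum_const, card_univ, Fintype.card_fin,
    nsmul_eq_mul, mul_one]
  rw [show ∑ v, (2 : ℝ) ^ T.deg v = T.sumTwoPowDeg from rfl]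
  ring

lemma sum_pow_deg_root_attach {n : ℕ} (T : RecTree n) (x : ℝ) :
    ∑ p, x ^ (T.attach p).deg (T.attach p).root = (n - 1 + x) * x ^ T.deg T.root := by
  have h (p : Fin n) : x ^ (T.attach p).deg (T.attach p).root
      = x ^ T.deg T.root + if p = T.root then (x - 1) * x ^ T.deg T.root else 0 := by
    rw [show (T.attach p).root = T.root.castSucc from rfl, deg_attach_castSucc]
    split_ifs
    · ring
    · simp
  simp only [h, sum_add_distrib, sum_const, card_univ, Fintype.card_fin, nsmul_eq_mul, sum_ite_eq',
    mem_univ, if_true]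
  ring

/-- The number of cuts exceeds `B` only if the root has degree at most `a` or there are more than
`B` vertices of degree at least `a`. -/
lemma one_le_of_lt_numCuts {n : ℕ} (T : RecTree n) (σ : T.DegreeOrder) (S : Set (Fin n))
    {x a B : ℝ} (hx : 0 < x) (hx1 : x ≤ 1) (hB : 0 < B)
    (h : B < T.numCuts (List.ofFn σ.1) S) :
    1 ≤ x ^ (-a) * x ^ T.deg T.root + 2 ^ (-a) / B * T.sumTwoPowDeg := by
  have hs := T.sumTwoPowDeg_nonneg
  rcases le_total (T.deg T.root : ℝ) a with ha | ha
  · have : 1 ≤ x ^ (-a) * x ^ T.deg T.root := by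
      rw [← Real.rpow_natCast, ← Real.rpow_add hx]
      exact Real.one_le_rpow_of_pos_of_le_one_of_nonpos hx hx1 (by linarith)
    have : 0 ≤ 2 ^ (-a) / B * T.sumTwoPowDeg := by positivity
    linarith
  -- Markov: each counted vertex has weight `2 ^ (deg v - a) ≥ 1`.
  · have h1 : (#{v | T.deg T.root ≤ T.deg v} : ℝ) ≤ 2 ^ (-a) * T.sumTwoPowDeg := by
      rw [sumTwoPowDeg, mul_sum, card_filter, Nat.cast_sum]
      refine sum_le_sum fun v _ => ?_
      split_ifs with hv
      · rw [← Real.rpow_natCast, ← Real.rpow_add two_pos, Nat.cast_one]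
        have : (T.deg T.root : ℝ) ≤ T.deg v := by exact_mod_cast hv
        exact Real.one_le_rpow one_le_two (by linarith)
      · rw [Nat.cast_zero]; positivity
    have h2 : B ≤ 2 ^ (-a) * T.sumTwoPowDeg :=
      h.le.trans (le_trans (by exact_mod_cast T.numCuts_degreeOrder_le σ S) h1)
    have h3 : 1 ≤ 2 ^ (-a) / B * T.sumTwoPowDeg := by
      rw [div_mul_eq_mul_div, le_div_iff₀ hB]; linarith
    have : 0 ≤ x ^ (-a) * x ^ T.deg T.root := by positivity
    linarith

end RecTree

/-! ### Expectations over the random tree. -/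

namespace PMF

lemma tsum_bind_mul {α β : Type*} (p : PMF α) (q : α → PMF β) (f : β → ENNReal) :
    ∑' b, p.bind q b * f b = ∑' a, p a * ∑' b, q a b * f b := by
  simp only [bind_apply, ← ENNReal.tsum_mul_right, ← ENNReal.tsum_mul_left]
  rw [ENNReal.tsum_comm]
  simp only [mul_assoc]

lemma tsum_map_mul {α β : Type*} (p : PMF α) (g : α → β) (f : β → ENNReal) :
    ∑' b, p.map g b * f b = ∑' a, p a * f (g a) := by
  classical
  rw [← bind_pure_comp, tsum_bind_mul]
  refine tsum_congr fun a => ?_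
  rw [tsum_eq_single (g a) fun b hb => by simp [hb]]
  simp

end PMF

/-- If the average of `f` over the attachments to a tree is at most an affine function of `f`, the
expectation of `f` is bounded by any solution of the corresponding recursive inequality. -/
lemma tsum_randomRecTree_mul_le (f : ∀ {n : ℕ}, RecTree n → ℝ) (hf : ∀ {n} (T : RecTree n), 0 ≤ f T)
    (a b e : ℕ → ℝ) (ha : ∀ n, 0 < n → 0 ≤ a n) (hb : ∀ n, 0 ≤ b n) (he0 : ∀ n, 0 ≤ e n)
    (hstep : ∀ {n} (T : RecTree n), 0 < n → ∑ p, f (T.attach p) ≤ n * (a n * f T + b n))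
    (h1 : f RecTree.single ≤ e 1) (he : ∀ n, 0 < n → a n * e n + b n ≤ e (n + 1))
    (n : ℕ) (hn : 0 < n) :
    ∑' T, randomRecTree n hn T * ENNReal.ofReal (f T) ≤ ENNReal.ofReal (e n) := by
  induction n, hn using Nat.le_induction with
  | base =>
    rw [show randomRecTree 1 _ = PMF.pure RecTree.single from rfl,
      tsum_eq_single RecTree.single fun b hb => by simp [hb]]
    simpa using ENNReal.ofReal_le_ofReal h1
  | succ n hn ih =>
    obtain ⟨m, rfl⟩ : ∃ m, n = m + 1 := ⟨n - 1, by omega⟩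
    have hm : 0 < m + 1 := m.succ_pos
    have key (T : RecTree (m + 1)) :
        ∑' T', (PMF.uniformOfFintype (Fin (m + 1))).map (fun p => T.attach p) T'
            * ENNReal.ofReal (f T')
          ≤ ENNReal.ofReal (a (m + 1)) * ENNReal.ofReal (f T) + ENNReal.ofReal (b (m + 1)) := by
      rw [PMF.tsum_map_mul, tsum_fintype]
      simp only [PMF.uniformOfFintype_apply, Fintype.card_fin]
      rw [← mul_sum, ← ENNReal.ofReal_sum_of_nonneg fun p _ => hf _,
        ← ENNReal.ofReal_mul (ha _ hm), ← ENNReal.ofReal_add (mul_nonneg (ha _ hm) (hf T)) (hb _)]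
      calc ((m + 1 : ℕ) : ENNReal)⁻¹ * ENNReal.ofReal (∑ p, f (T.attach p))
          ≤ ((m + 1 : ℕ) : ENNReal)⁻¹ *
            (((m + 1 : ℕ) : ENNReal) * ENNReal.ofReal (a (m + 1) * f T + b (m + 1))) := by
            gcongr
            rw [← ENNReal.ofReal_natCast, ← ENNReal.ofReal_mul (Nat.cast_nonneg _)]
            exact ENNReal.ofReal_le_ofReal (hstep T hm)
        _ = _ := ENNReal.inv_mul_cancel_left (by simp) (by simp)
    rw [show randomRecTree (m + 1 + 1) _ = (randomRecTree (m + 1) m.succ_pos).bind fun T =>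
        (PMF.uniformOfFintype (Fin (m + 1))).map fun p => T.attach p from rfl, PMF.tsum_bind_mul]
    calc _ ≤ ∑' T, randomRecTree (m + 1) hm T *
          (ENNReal.ofReal (a (m + 1)) * ENNReal.ofReal (f T) + ENNReal.ofReal (b (m + 1))) :=
          ENNReal.tsum_le_tsum fun T => mul_le_mul_right (key T) _
      _ = ENNReal.ofReal (a (m + 1)) * ∑' T, randomRecTree (m + 1) hm T * ENNReal.ofReal (f T)
          + ENNReal.ofReal (b (m + 1)) := by
          simp only [mul_add, ENNReal.tsum_add, ENNReal.tsum_mul_right, PMF.tsum_coe, one_mul]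
          rw [← ENNReal.tsum_mul_left]
          simp only [mul_left_comm]
      _ ≤ ENNReal.ofReal (a (m + 1)) * ENNReal.ofReal (e (m + 1)) + ENNReal.ofReal (b (m + 1)) := by
          gcongr
      _ ≤ ENNReal.ofReal (e (m + 1 + 1)) := by
          rw [← ENNReal.ofReal_mul (ha _ hm),
            ← ENNReal.ofReal_add (mul_nonneg (ha _ hm) (he0 _)) (hb _)]
          exact ENNReal.ofReal_le_ofReal (he _ hm)

lemma tsum_randomRecTree_mul_sumTwoPowDeg_le (n : ℕ) (hn : 0 < n) :
    ∑' T, randomRecTree n hn T * ENNReal.ofReal T.sumTwoPowDeg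
      ≤ ENNReal.ofReal (n * (1 + Real.log n)) := by
  refine tsum_randomRecTree_mul_le (fun T => T.sumTwoPowDeg) (fun T => T.sumTwoPowDeg_nonneg)
    (fun n => 1 + 1 / n) (fun _ => 1) (fun n => n * (1 + Real.log n)) (fun n _ => by positivity)
    (fun _ => zero_le_one) (fun n => mul_nonneg n.cast_nonneg
      (add_nonneg zero_le_one (Real.log_natCast_nonneg n))) (fun {n} T h => ?_) ?_ (fun n h => ?_) n hn
  · have : (0 : ℝ) < n := by exact_mod_cast h
    rw [RecTree.sum_sumTwoPowDeg_attach]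
    refine le_of_eq ?_
    field_simp
  · simp [RecTree.sumTwoPowDeg, RecTree.deg_single]
  · have h0 : (0 : ℝ) < n := by exact_mod_cast h
    -- The recursion closes because `ln (n + 1) - ln n ≥ 1 / (n + 1)`.
    have hlog := Real.one_sub_inv_le_log_of_pos (show (0 : ℝ) < (n + 1) / n by positivity)
    rw [Real.log_div (by positivity) (by positivity)] at hlog
    have h2 : ((n : ℝ) + 1) * (1 - ((n + 1) / n : ℝ)⁻¹) = 1 := by field_simp; ring
    have h3 := mul_le_mul_of_nonneg_left hlog (show (0 : ℝ) ≤ n + 1 by positivity)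
    have h4 : (1 + 1 / (n : ℝ)) * (n * (1 + Real.log n)) = (n + 1) * (1 + Real.log n) := by
      field_simp
    push_cast
    rw [h4]
    linarith

lemma tsum_randomRecTree_mul_pow_deg_root_le {t : ℝ} (ht : 0 ≤ t) (ht1 : t ≤ 1) (n : ℕ)
    (hn : 0 < n) :
    ∑' T, randomRecTree n hn T * ENNReal.ofReal ((1 - t) ^ T.deg T.root)
      ≤ ENNReal.ofReal ((n : ℝ) ^ (-t)) := by
  refine tsum_randomRecTree_mul_le (fun T => (1 - t) ^ T.deg T.root)
    (fun T => pow_nonneg (by linarith) _)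
    (fun n => 1 - t / n) (fun _ => 0) (fun n => (n : ℝ) ^ (-t)) (fun n h => ?_)
    (fun _ => le_rfl) (fun n => Real.rpow_nonneg n.cast_nonneg _) (fun {n} T h => ?_) ?_ (fun n h => ?_) n hn
  · have : (1 : ℝ) ≤ n := by exact_mod_cast h
    rw [sub_nonneg, div_le_one (by linarith)]
    linarith
  · have : (0 : ℝ) < n := by exact_mod_cast h
    rw [RecTree.sum_pow_deg_root_attach]
    refine le_of_eq ?_
    field_simp
    ring
  · simp [RecTree.deg_single]
  · have h0 : (0 : ℝ) < n := by exact_mod_cast h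
    -- Bernoulli's inequality; with `(1 - t/n)(1 + t/n) ≤ 1` it gives `1 - t/n ≤ (n / (n + 1)) ^ t`.
    have hB : ((n + 1 : ℝ) / n) ^ t ≤ 1 + t / n := by
      have := rpow_one_add_le_one_add_mul_self (s := 1 / (n : ℝ)) (p := t)
        (by have : 0 < 1 / (n : ℝ) := by positivity
            linarith) ht ht1
      rw [show (n + 1 : ℝ) / n = 1 + 1 / n by field_simp]
      simpa [div_eq_mul_inv] using this
    rw [Real.div_rpow (by positivity) h0.le, div_le_iff₀ (by positivity)] at hB
    have hn1 : 0 < (n : ℝ) ^ t := by positivity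
    have hn2 : 0 < (n + 1 : ℝ) ^ t := by positivity
    have h1 : 0 ≤ 1 - t / n := by
      have : (1 : ℝ) ≤ n := by exact_mod_cast h
      rw [sub_nonneg, div_le_one (by linarith)]
      linarith
    push_cast
    rw [Real.rpow_neg h0.le, Real.rpow_neg (by positivity), add_zero, ← div_eq_mul_inv,
      div_le_iff₀ hn1, ← div_eq_inv_mul, le_div_iff₀ hn2]
    calc (1 - t / n) * (n + 1 : ℝ) ^ t ≤ (1 - t / n) * ((1 + t / n) * n ^ t) := by gcongr
      _ = (1 - (t / n) ^ 2) * n ^ t := by ring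
      _ ≤ 1 * n ^ t := by
        gcongr
        nlinarith [sq_nonneg (t / n)]
      _ = n ^ t := one_mul _

lemma targetedCutsLaw_real_lt_le (n : ℕ) (hn : 0 < n) {t a B : ℝ} (ht : 0 ≤ t) (ht1 : t < 1)
    (hB : 0 < B) :
    (targetedCutsLaw n hn).toMeasure.real {k : ℕ | B < (k : ℝ)}
      ≤ (1 - t) ^ (-a) * (n : ℝ) ^ (-t) + 2 ^ (-a) / B * (n * (1 + Real.log n)) := by
  have hn1 : (1 : ℝ) ≤ n := by exact_mod_cast hn
  have hlog := Real.log_nonneg hn1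
  have hx : 0 < 1 - t := by linarith
  have hc : 0 ≤ (1 - t) ^ (-a) := by positivity
  have hd : 0 ≤ 2 ^ (-a) / B := by positivity
  refine ENNReal.toReal_le_of_le_ofReal (by positivity) ?_
  rw [PMF.toMeasure_apply _ (by measurability)]
  calc ∑' k, {k : ℕ | B < (k : ℝ)}.indicator (targetedCutsLaw n hn) k
      = ∑' k, targetedCutsLaw n hn k * {k : ℕ | B < (k : ℝ)}.indicator 1 k := by
        refine tsum_congr fun k => ?_
        by_cases h : B < (k : ℝ) <;> simp [Set.indicator, h]
    _ = ∑' T, randomRecTree n hn T * ∑' σ, PMF.uniformOfFintype T.DegreeOrder σ *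
          {k : ℕ | B < (k : ℝ)}.indicator 1 (T.numCuts (List.ofFn σ.1) Set.univ) := by
        rw [targetedCutsLaw, PMF.tsum_bind_mul]
        simp only [PMF.tsum_map_mul]
    _ ≤ ∑' T, randomRecTree n hn T *
          (ENNReal.ofReal ((1 - t) ^ (-a)) * ENNReal.ofReal ((1 - t) ^ T.deg T.root)
            + ENNReal.ofReal (2 ^ (-a) / B) * ENNReal.ofReal T.sumTwoPowDeg) := by
        refine ENNReal.tsum_le_tsum fun T => mul_le_mul_right ?_ _
        rw [← ENNReal.ofReal_mul hc, ← ENNReal.ofReal_mul hd, ← ENNReal.ofReal_add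
          (mul_nonneg hc (pow_nonneg hx.le _)) (mul_nonneg hd T.sumTwoPowDeg_nonneg)]
        -- The pointwise bound does not depend on `σ`, so the random tie-breaking averages out.
        calc _ ≤ ∑' σ, PMF.uniformOfFintype T.DegreeOrder σ * ENNReal.ofReal
              ((1 - t) ^ (-a) * (1 - t) ^ T.deg T.root + 2 ^ (-a) / B * T.sumTwoPowDeg) := by
              refine ENNReal.tsum_le_tsum fun σ => mul_le_mul_right ?_ _
              refine Set.indicator_apply_le' (fun h => ?_) fun _ => zero_le
              rw [Pi.one_apply, ENNReal.one_le_ofReal]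
              exact T.one_le_of_lt_numCuts σ _ hx (by linarith) hB h
          _ = _ := by rw [ENNReal.tsum_mul_right, PMF.tsum_coe, one_mul]
    _ = ENNReal.ofReal ((1 - t) ^ (-a)) *
          ∑' T, randomRecTree n hn T * ENNReal.ofReal ((1 - t) ^ T.deg T.root)
        + ENNReal.ofReal (2 ^ (-a) / B) *
          ∑' T, randomRecTree n hn T * ENNReal.ofReal T.sumTwoPowDeg := by
        simp only [mul_add, ENNReal.tsum_add, ← ENNReal.tsum_mul_left, mul_left_comm]
    _ ≤ ENNReal.ofReal ((1 - t) ^ (-a)) * ENNReal.ofReal ((n : ℝ) ^ (-t))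
        + ENNReal.ofReal (2 ^ (-a) / B) * ENNReal.ofReal (n * (1 + Real.log n)) := by
        gcongr
        · exact tsum_randomRecTree_mul_pow_deg_root_le ht ht1.le n hn
        · exact tsum_randomRecTree_mul_sumTwoPowDeg_le n hn
    _ = _ := by
        rw [← ENNReal.ofReal_mul hc, ← ENNReal.ofReal_mul hd, ← ENNReal.ofReal_add
          (by positivity) (by positivity)]

/-! ### Asymptotics of the two error terms. -/

lemma tendsto_rootDeg_bound {η : ℝ} (h0 : 0 < η) (h1 : η ≤ 1) :
    Tendsto (fun n : ℕ => (1 - η / 2) ^ (-((1 - η) * Real.log n)) * (n : ℝ) ^ (-(η / 2)))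
      atTop (𝓝 0) := by
  -- With `t = η / 2` and `a = (1 - η) ln n` the term is exactly `n ^ (-c)`; `ln x ≥ 1 - 1/x` shows
  -- that `c` is positive, of second order in `η`.
  set c := η / 2 + (1 - η) * Real.log (1 - η / 2) with hc
  have hx : 0 < 1 - η / 2 := by linarith
  have hc0 : 0 < c := by
    have h := Real.one_sub_inv_le_log_of_pos hx
    have h2 : (1 - η) * (1 - (1 - η / 2)⁻¹) ≤ (1 - η) * Real.log (1 - η / 2) := by
      gcongr
    have h3 : η / 2 + (1 - η) * (1 - (1 - η / 2)⁻¹) = (η / 2) ^ 2 / (1 - η / 2) := by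
      have : 2 - η ≠ 0 := by linarith
      field_simp
      ring
    have h4 : 0 < (η / 2) ^ 2 / (1 - η / 2) := by positivity
    linarith
  refine ((tendsto_rpow_neg_atTop hc0).comp tendsto_natCast_atTop_atTop).congr' ?_
  filter_upwards [eventually_gt_atTop 0] with n hn
  have hn0 : (0 : ℝ) < n := by exact_mod_cast hn
  simp only [Function.comp]
  rw [Real.rpow_def_of_pos hx, Real.rpow_def_of_pos hn0, Real.rpow_def_of_pos hn0, ← Real.exp_add,
    hc]
  ring_nf

lemma tendsto_sumTwoPowDeg_bound {ε η : ℝ} (h0 : 0 < η) (h1 : η ≤ ε) :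
    Tendsto (fun n : ℕ => 2 ^ (-((1 - η) * Real.log n)) / (n : ℝ) ^ ((1 - Real.log 2) + ε)
      * (n * (1 + Real.log n))) atTop (𝓝 0) := by
  -- Replacing `ln n` by `(1 - η) ln n` costs `η ln 2 < ε` in the exponent; the remaining `n ^ (-c)`
  -- absorbs the logarithm.
  set c := ε - η * Real.log 2 with hc
  have hc0 : 0 < c := by nlinarith [Real.log_two_lt_d9]
  have hT : Tendsto (fun x : ℝ => x ^ (-c) + Real.log x / x ^ c) atTop (𝓝 0) := by
    simpa using (tendsto_rpow_neg_atTop hc0).add (isLittleO_log_rpow_atTop hc0).tendsto_div_nhds_zero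
  refine (hT.comp tendsto_natCast_atTop_atTop).congr' ?_
  filter_upwards [eventually_gt_atTop 0] with n hn
  have hn0 : (0 : ℝ) < n := by exact_mod_cast hn
  have h : (2 : ℝ) ^ (-((1 - η) * Real.log n)) / (n : ℝ) ^ ((1 - Real.log 2) + ε) * n
      = (n : ℝ) ^ (-c) := by
    nth_rw 3 [← Real.exp_log hn0]
    rw [Real.rpow_def_of_pos two_pos, Real.rpow_def_of_pos hn0, Real.rpow_def_of_pos hn0,
      ← Real.exp_sub, ← Real.exp_add, hc]
    ring_nf
  simp only [Function.comp]
  rw [← mul_assoc, h, div_eq_mul_inv, ← Real.rpow_neg hn0.le]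
  ring

theorem theorem1p1 (ε : ℝ) (hε : 0 < ε) (δ : ℝ) (hδ : 0 < δ) :
    ∃ M : ℝ, 0 < M ∧ ∃ N : ℕ, ∀ (n : ℕ) (hn : 0 < n), N ≤ n →
      (targetedCutsLaw n hn).toMeasure.real
        {k : ℕ | M * (n : ℝ) ^ ((1 - Real.log 2) + ε) < (k : ℝ)} < δ := by
  have hη : 0 < min ε 1 := lt_min hε one_pos
  have hη1 : min ε 1 ≤ 1 := min_le_right _ _
  have h := (tendsto_rootDeg_bound hη hη1).add
    (tendsto_sumTwoPowDeg_bound (ε := ε) hη (min_le_left _ _))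
  rw [add_zero] at h
  obtain ⟨N, hN⟩ := eventually_atTop.1 (h.eventually_lt_const hδ)
  -- `M = 1` suffices, as the bound tends to 0.
  refine ⟨1, one_pos, N, fun n hn hNn => ?_⟩
  have hn0 : (0 : ℝ) < n := by exact_mod_cast hn
  rw [one_mul]
  exact (targetedCutsLaw_real_lt_le n hn (by linarith) (by linarith) (by positivity)).trans_lt
    (hN n hNn)
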